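/- Theorem 1. Let $n\in\mathbb N$, let $|\cdot|$ be the Euclidean norm on $\mathbb R^{n}$, let $f_{cl}:\mathbb R^{n}\to\mathbb R^{n}$ and, for each $i\ge 1$, $g_{cl,i}:(\mathbb R^{n})^{i}\to\mathbb R^{n}$ be maps with $f_{cl}(0)=0$ and $g_{cl,i}(0,\dots,0)=0$. For $N\in\mathbb N$ consider the cascaded closed-loop platoon of $N+1$ vehicles (in error coordinates) $$\dot{\tilde\chi}_0=f_{cl}(\tilde\chi_0),\qquad \dot{\tilde\chi}_i=f_{cl}(\tilde\chi_i)+g_{cl,i}(\tilde\chi_{i-1},\dots,\tilde\chi_0),\quad i=1,\dots,N,$$ where trajectories are absolutely continuous and satisfy the equations almost everywhere. Suppose there are $\beta$ of class $\mathcal{KL}$ and $\gamma$ of class $\mathcal K_\infty$, not depending on $i$ or $N$, such that for every $N$ trajectories exist for all $t\ge 0$ from every initial state, and every trajectory satisfies, for each $i\in\{0,\dots,N\}$ and each $t\ge 0$ up to which it is defined, $$|\tilde\chi_i(t)|\le\beta(|\tilde\chi_i(0)|,t)+\gamma\Big(\max_{j=0,\dots,i-1}\ \sup_{0\le\tau\le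 t}|\tilde\chi_j(\tau)|\Big)$$ (the maximum being $0$ for $i=0$). Suppose also that $\gamma(s)\le\tilde\gamma s$ for all $s\ge 0$, with some $\tilde\gamma\in(0,1)$. Then the platoon is String Stable: for every $\epsilon>0$ there is $\delta>0$ such that for all $N\in\mathbb N$, trajectories exist for all $t\ge0$ from every initial state with $\max_{0\le i\le N}|\tilde\chi_i(0)|<\delta$, and every trajectory with $\max_{0\le i\le N}|\tilde\chi_i(0)|<\delta$ satisfies $\max_{0\le i\le N}|\tilde\chi_i(t)|<\epsilon$ at all times $t\ge 0$ at which it is defined. If in addition the origin of the isolated subsystem $\dot x=f_{cl}(x)$ is exponentially stable (there are $c,k,\lambda>0$ such that from every $x(0)$ with $|x(0)|<c$ trajectories exist for all $t\ge 0$, and every such trajectory satisfies $|x(t)|\le k|x(0)|e^{-\lambda t}$) and, for each $i$, there are constants $k_{ij}\ge0$ with $|g_{cl,i}(y_{i-1},\dots,y_0)|\le\sum_{j=0}^{i-1}k_{ij}|y_j|$ for all $y_0,\dots,y_{i-1}\in\mathbb R^{n}$, then the platoon is Asymptotically String Stable: it is String Stable and, for all $N\in\mathbb N$, from every initial state trajectories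 exist for all $t\ge0$, and every trajectory defined for all $t\ge 0$ satisfies $\lim_{t\to\infty}|\tilde\chi_i(t)|=0$ for all $i\in\{0,\dots,N\}$. -/

import Mathlib

open Set Filter Topology MeasureTheory

noncomputable section

namespace Platoon

/-- The state space `ℝⁿ` of one vehicle (error coordinates), with the Euclidean norm. -/
abbrev State (n : ℕ) : Type := EuclideanSpace ℝ (Fin n)

/-- Class `𝒦` functions on `[0, ∞)`. -/
structure ClassK (α : ℝ → ℝ) : Prop where
  continuousOn : ContinuousOn α (Ici 0)
  strictMonoOn : StrictMonoOn α (Ici 0)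
  map_zero : α 0 = 0

/-- Class `𝒦_∞` functions on `[0, ∞)`. -/
structure ClassKInfty (α : ℝ → ℝ) : Prop extends ClassK α where
  tendsto_atTop : Tendsto α atTop atTop

/-- Class `𝒦ℒ` functions on `[0, ∞) × [0, ∞)`. -/
structure ClassKL (β : ℝ → ℝ → ℝ) : Prop where
  continuousOn : ContinuousOn (fun p : ℝ × ℝ => β p.1 p.2) (Ici 0 ×ˢ Ici 0)
  classK : ∀ t, 0 ≤ t → ClassK (fun r => β r t)
  antitoneOn : ∀ r, 0 ≤ r → AntitoneOn (fun t => β r t) (Ici 0)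
  tendsto_zero : ∀ r, 0 ≤ r → Tendsto (fun t => β r t) atTop (𝓝 0)

/-- `ẋ = v` on `[0, T]` in the sense of Carathéodory: `x` is the integral of the integrable
function `v`, i.e. `x` is absolutely continuous and `ẋ(t) = v(t)` for almost every `t`.
(When `v` is continuous this is the classical derivative.) -/
def HasVelocityOn {n : ℕ} (x v : ℝ → State n) (T : ℝ) : Prop :=
  IntervalIntegrable v volume 0 T ∧ ∀ t ∈ Icc 0 T, x t = x 0 + ∫ s in 0..t, v s

/-- `x` is a trajectory on `[0, T]` of the isolated subsystem `ẋ = f(x)`. -/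
def IsIsolatedSolution {n : ℕ} (f : State n → State n) (T : ℝ) (x : ℝ → State n) : Prop :=
  HasVelocityOn x (fun t => f (x t)) T

/-- The family of the states `χ_0, …, χ_{i-1}` of the vehicles preceding vehicle `i`. -/
def preceding {N : ℕ} {α : Type*} (χ : Fin (N + 1) → α) (i : Fin (N + 1)) : Fin i.val → α :=
  fun j => χ ⟨j, j.isLt.trans i.isLt⟩

/-- `χ = (χ_0, …, χ_N)` is a trajectory on `[0, T]` of the platoon of `N + 1` vehicles
`χ̇_i = f(χ_i) + g_i(χ_{i-1}, …, χ_0)`, `i = 0, …, N`. The function `g_0` has no arguments, and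
it vanishes under the assumption `g_i(0, …, 0) = 0`, so that `χ̇_0 = f(χ_0)`. -/
def IsPlatoonSolution {n : ℕ} (f : State n → State n) (g : (i : ℕ) → (Fin i → State n) → State n)
    (N : ℕ) (T : ℝ) (χ : Fin (N + 1) → ℝ → State n) : Prop :=
  ∀ i, HasVelocityOn (χ i) (fun t => f (χ i t) + g i (preceding (fun j => χ j t) i)) T

/-- The maximum over the vehicles `0, …, N` of the Euclidean norms of their states. -/
def maxNorm {n N : ℕ} (x : Fin (N + 1) → State n) : ℝ :=
  Finset.univ.sup' Finset.univ_nonempty fun i => ‖x i‖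

/-- The signal norm `sup_{0 ≤ τ ≤ t} |x(τ)|`. -/
def signalNorm {n : ℕ} (x : ℝ → State n) (t : ℝ) : ℝ :=
  sSup ((fun τ => ‖x τ‖) '' Icc 0 t)

/-- The maximum over the vehicles preceding `i` of their signal norms on `[0, t]`; it is `0` if
there are none. -/
def precedingNorm {n N : ℕ} (χ : Fin (N + 1) → ℝ → State n) (i : Fin (N + 1)) (t : ℝ) : ℝ :=
  ⨆ j : Fin i.val, signalNorm (preceding χ i j) t

/-- Every initial state of the platoon of `N + 1` vehicles that satisfies `P` is the initial state
of a trajectory defined for all `t ≥ 0`. -/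
def ExistsForAllTime {n : ℕ} (f : State n → State n)
    (g : (i : ℕ) → (Fin i → State n) → State n) (N : ℕ) (P : (Fin (N + 1) → State n) → Prop) :
    Prop :=
  ∀ x₀ : Fin (N + 1) → State n, P x₀ →
    ∃ χ : Fin (N + 1) → ℝ → State n, (∀ i, χ i 0 = x₀ i) ∧ ∀ T, 0 ≤ T → IsPlatoonSolution f g N T χ

/-- The input-to-state stability estimate with the functions `β` and `γ`, common to all vehicles
and all platoon lengths: trajectories exist for all `t ≥ 0` from every initial state, and every
trajectory satisfies the estimate at each time `t` up to which it is defined. -/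
def IsISS {n : ℕ} (f : State n → State n) (g : (i : ℕ) → (Fin i → State n) → State n)
    (β : ℝ → ℝ → ℝ) (γ : ℝ → ℝ) : Prop :=
  ∀ N : ℕ, ExistsForAllTime f g N (fun _ => True) ∧
    ∀ (t : ℝ), 0 ≤ t → ∀ χ : Fin (N + 1) → ℝ → State n, IsPlatoonSolution f g N t χ →
      ∀ i, ‖χ i t‖ ≤ β ‖χ i 0‖ t + γ (precedingNorm χ i t)

/-- String Stability of the origin: `δ` does not depend on the number of vehicles. -/
def StringStable {n : ℕ} (f : State n → State n) (g : (i : ℕ) → (Fin i → State n) → State n) :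
    Prop :=
  ∀ ε : ℝ, 0 < ε → ∃ δ : ℝ, 0 < δ ∧ ∀ N : ℕ,
    ExistsForAllTime f g N (fun x₀ => maxNorm x₀ < δ) ∧
    ∀ (t : ℝ), 0 ≤ t → ∀ χ : Fin (N + 1) → ℝ → State n, IsPlatoonSolution f g N t χ →
      maxNorm (fun i => χ i 0) < δ → maxNorm (fun i => χ i t) < ε

/-- Asymptotic String Stability of the origin: String Stability, and for every platoon length and
every initial state the trajectories exist for all times and converge to the origin. -/
def AsymptoticallyStringStable {n : ℕ} (f : State n → State n)
    (g : (i : ℕ) → (Fin i → State n) → State n) : Prop :=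
  StringStable f g ∧ ∀ N : ℕ,
    ExistsForAllTime f g N (fun _ => True) ∧
    ∀ χ : Fin (N + 1) → ℝ → State n, (∀ T, 0 ≤ T → IsPlatoonSolution f g N T χ) →
      ∀ i, Tendsto (fun t => ‖χ i t‖) atTop (𝓝 0)

/-- (Local) exponential stability of the origin of the isolated subsystem `ẋ = f(x)`. -/
def IsolatedExponentiallyStable {n : ℕ} (f : State n → State n) : Prop :=
  ∃ c k lam : ℝ, 0 < c ∧ 0 < k ∧ 0 < lam ∧
    (∀ x₀ : State n, ‖x₀‖ < c →
      ∃ x : ℝ → State n, x 0 = x₀ ∧ ∀ T, 0 ≤ T → IsIsolatedSolution f T x) ∧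
    ∀ (t : ℝ), 0 ≤ t → ∀ x : ℝ → State n, IsIsolatedSolution f t x → ‖x 0‖ < c →
      ‖x t‖ ≤ k * ‖x 0‖ * Real.exp (-lam * t)

/-- Each interconnection term `g_i` is bounded by a nonnegative linear combination of the norms of
its arguments. -/
def LinearlyBounded {n : ℕ} (g : (i : ℕ) → (Fin i → State n) → State n) : Prop :=
  ∀ i : ℕ, ∃ k : Fin i → ℝ, (∀ j, 0 ≤ k j) ∧
    ∀ y : Fin i → State n, ‖g i y‖ ≤ ∑ j, k j * ‖y j‖

end Platoon

end

namespace Platoon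

/-! Both claims go by strong induction on the vehicle index. If all initial norms are at most δ,
then B = β(δ,0)/(1 - γ̃) solves β(δ,0) + γ̃B = B, so a bound B on the predecessors passes unchanged
to the next vehicle; hence it is independent of N (`IsISS.norm_le`), and it is small with δ. For
convergence, time invariance (`HasVelocityOn.shift`) lets the estimate restart once the predecessors
are small: the gain term is then small and the β term decays (`IsISS.tendsto_norm_zero`). -/

theorem HasVelocityOn.mono {n : ℕ} {x v : ℝ → State n} {s T : ℝ} (hs : 0 ≤ s) (hsT : s ≤ T)
    (h : HasVelocityOn x v T) : HasVelocityOn x v s := by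
  refine ⟨h.1.mono_set ?_, fun t ht => h.2 t ⟨ht.1, ht.2.trans hsT⟩⟩
  rw [uIcc_of_le hs, uIcc_of_le (hs.trans hsT)]
  exact Icc_subset_Icc_right hsT

/-- The equation is time-invariant: the trajectory after time `a` is again a trajectory. -/
theorem HasVelocityOn.shift {n : ℕ} {x v : ℝ → State n} {a s : ℝ} (ha : 0 ≤ a) (hs : 0 ≤ s)
    (h : HasVelocityOn x v (a + s)) :
    HasVelocityOn (fun t => x (a + t)) (fun t => v (a + t)) s := by
  have hint : ∀ b c, 0 ≤ b → b ≤ c → c ≤ a + s → IntervalIntegrable v volume b c := by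
    intro b c hb hbc hc
    refine h.1.mono_set ?_
    rw [uIcc_of_le hbc, uIcc_of_le (by linarith)]
    exact Icc_subset_Icc hb hc
  constructor
  · have := (hint a (a + s) ha (by linarith) le_rfl).comp_add_left a
    simpa using this
  · intro t ht
    have h1 := h.2 (a + t) ⟨by linarith [ht.1], by linarith [ht.2]⟩
    have h2 := h.2 a ⟨ha, by linarith⟩
    have h3 := intervalIntegral.integral_add_adjacent_intervals
      (hint 0 a le_rfl ha (by linarith))
      (hint a (a + t) ha (by linarith [ht.1]) (by linarith [ht.2]))
    have h4 : ∫ r in 0..t, v (a + r) = ∫ r in a..(a + t), v r := by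
      simp [intervalIntegral.integral_comp_add_left]
    simp only [add_zero]
    rw [h4, h1, h2, ← h3, add_assoc]

theorem IsPlatoonSolution.mono {n N : ℕ} {f : State n → State n}
    {g : (i : ℕ) → (Fin i → State n) → State n} {s T : ℝ} {χ : Fin (N + 1) → ℝ → State n}
    (hs : 0 ≤ s) (hsT : s ≤ T) (h : IsPlatoonSolution f g N T χ) : IsPlatoonSolution f g N s χ :=
  fun i => (h i).mono hs hsT

theorem IsPlatoonSolution.shift {n N : ℕ} {f : State n → State n}
    {g : (i : ℕ) → (Fin i → State n) → State n} {a s : ℝ} {χ : Fin (N + 1) → ℝ → State n}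
    (ha : 0 ≤ a) (hs : 0 ≤ s) (h : IsPlatoonSolution f g N (a + s) χ) :
    IsPlatoonSolution f g N s (fun i t => χ i (a + t)) :=
  fun i => (h i).shift ha hs

theorem precedingNorm_nonneg {n N : ℕ} (χ : Fin (N + 1) → ℝ → State n) (i : Fin (N + 1))
    (t : ℝ) : 0 ≤ precedingNorm χ i t := by
  refine Real.iSup_nonneg fun j => Real.sSup_nonneg ?_
  rintro _ ⟨τ, -, rfl⟩
  exact norm_nonneg _

/-- The hypothesis `0 ≤ B` covers the empty suprema (`i = 0` or `t < 0`), whose value is 0. -/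
theorem precedingNorm_le {n N : ℕ} {χ : Fin (N + 1) → ℝ → State n} {i : Fin (N + 1)} {t B : ℝ}
    (hB : 0 ≤ B) (h : ∀ j < i, ∀ τ ∈ Icc 0 t, ‖χ j τ‖ ≤ B) : precedingNorm χ i t ≤ B := by
  refine Real.iSup_le (fun j => Real.sSup_le ?_ hB) hB
  rintro _ ⟨τ, hτ, rfl⟩
  exact h _ j.isLt τ hτ

theorem norm_le_maxNorm {n N : ℕ} (x : Fin (N + 1) → State n) (i : Fin (N + 1)) :
    ‖x i‖ ≤ maxNorm x :=
  Finset.le_sup' (fun i => ‖x i‖) (Finset.mem_univ i)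

theorem maxNorm_lt_iff {n N : ℕ} {x : Fin (N + 1) → State n} {ε : ℝ} :
    maxNorm x < ε ↔ ∀ i, ‖x i‖ < ε := by
  simp [maxNorm, Finset.sup'_lt_iff]

theorem ClassKL.nonneg {β : ℝ → ℝ → ℝ} (hβ : ClassKL β) {r t : ℝ} (hr : 0 ≤ r) (ht : 0 ≤ t) :
    0 ≤ β r t := by
  rw [← (hβ.classK t ht).map_zero]
  exact (hβ.classK t ht).strictMonoOn.monotoneOn self_mem_Ici hr hr

theorem ClassK.exists_lt {α : ℝ → ℝ} (hα : ClassK α) {ε : ℝ} (hε : 0 < ε) :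
    ∃ δ, 0 < δ ∧ α δ < ε := by
  -- The one-sided filter at 0 makes the witness δ strictly positive.
  have h0 : Tendsto α (𝓝[>] 0) (𝓝 0) := by
    have := hα.continuousOn 0 self_mem_Ici
    rw [ContinuousWithinAt, hα.map_zero] at this
    exact this.mono_left (nhdsWithin_mono _ Ioi_subset_Ici_self)
  obtain ⟨δ, hδ, hpos⟩ := ((h0.eventually_lt_const hε).and self_mem_nhdsWithin).exists
  exact ⟨δ, hpos, hδ⟩

/-- A contractive gain makes the bound on all vehicles independent of the platoon length. -/
theorem IsISS.norm_le {n N : ℕ} {f : State n → State n}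
    {g : (i : ℕ) → (Fin i → State n) → State n} {β : ℝ → ℝ → ℝ} {γ : ℝ → ℝ} {γt : ℝ}
    (hISS : IsISS f g β γ) (hβ : ClassKL β) (hγt : γt ∈ Ioo (0 : ℝ) 1)
    (hlin : ∀ s, 0 ≤ s → γ s ≤ γt * s) {δ t : ℝ} (hδ : 0 ≤ δ) {χ : Fin (N + 1) → ℝ → State n}
    (hχ : IsPlatoonSolution f g N t χ) (h0 : ∀ i, ‖χ i 0‖ ≤ δ) (i : Fin (N + 1)) :
    ∀ τ ∈ Icc 0 t, ‖χ i τ‖ ≤ β δ 0 / (1 - γt) := by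
  have h1 : 0 < 1 - γt := sub_pos.2 hγt.2
  induction i using WellFoundedLT.induction with
  | ind i ih =>
    intro τ hτ
    have hβτ : β ‖χ i 0‖ τ ≤ β δ 0 :=
      (hβ.antitoneOn _ (norm_nonneg _) self_mem_Ici hτ.1 hτ.1).trans
        ((hβ.classK 0 le_rfl).strictMonoOn.monotoneOn (norm_nonneg _) hδ (h0 i))
    have hp : precedingNorm χ i τ ≤ β δ 0 / (1 - γt) :=
      precedingNorm_le (div_nonneg (hβ.nonneg hδ le_rfl) h1.le)
        fun j hj σ hσ => ih j hj σ ⟨hσ.1, hσ.2.trans hτ.2⟩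
    calc ‖χ i τ‖ ≤ β ‖χ i 0‖ τ + γ (precedingNorm χ i τ) :=
          (hISS N).2 τ hτ.1 χ (hχ.mono hτ.1 hτ.2) i
      _ ≤ β δ 0 + γt * (β δ 0 / (1 - γt)) :=
          add_le_add hβτ ((hlin _ (precedingNorm_nonneg _ _ _)).trans
            (mul_le_mul_of_nonneg_left hp hγt.1.le))
      -- The bound is the fixed point of s ↦ β(δ,0) + γ̃s.
      _ = β δ 0 / (1 - γt) := by field_simp; ring

theorem IsISS.stringStable {n : ℕ} {f : State n → State n}
    {g : (i : ℕ) → (Fin i → State n) → State n} {β : ℝ → ℝ → ℝ} {γ : ℝ → ℝ} {γt : ℝ}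
    (hISS : IsISS f g β γ) (hβ : ClassKL β) (hγt : γt ∈ Ioo (0 : ℝ) 1)
    (hlin : ∀ s, 0 ≤ s → γ s ≤ γt * s) : StringStable f g := by
  intro ε hε
  have h1 : 0 < 1 - γt := sub_pos.2 hγt.2
  -- The target ε(1 - γ̃) makes the uniform bound β(δ,0)/(1 - γ̃) less than ε.
  obtain ⟨δ, hδ, hδε⟩ := (hβ.classK 0 le_rfl).exists_lt (mul_pos hε h1)
  refine ⟨δ, hδ, fun N => ⟨fun x₀ _ => (hISS N).1 x₀ trivial, fun t ht χ hχ h0 => ?_⟩⟩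
  refine maxNorm_lt_iff.2 fun i => ?_
  exact (hISS.norm_le hβ hγt hlin hδ.le hχ
    (fun i => (norm_le_maxNorm (fun i => χ i 0) i).trans h0.le) i t ⟨ht, le_rfl⟩).trans_lt
      ((div_lt_iff₀ h1).2 hδε)

/-- Convergence passes from the preceding vehicles to the next one: restart the estimate at a time
after which the preceding states are small. -/
theorem IsISS.tendsto_norm_zero {n N : ℕ} {f : State n → State n}
    {g : (i : ℕ) → (Fin i → State n) → State n} {β : ℝ → ℝ → ℝ} {γ : ℝ → ℝ} {γt : ℝ}
    (hISS : IsISS f g β γ) (hβ : ClassKL β) (hγt : γt ∈ Ioo (0 : ℝ) 1)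
    (hlin : ∀ s, 0 ≤ s → γ s ≤ γt * s) {χ : Fin (N + 1) → ℝ → State n}
    (hχ : ∀ T, 0 ≤ T → IsPlatoonSolution f g N T χ) (i : Fin (N + 1)) :
    Tendsto (fun t => ‖χ i t‖) atTop (𝓝 0) := by
  induction i using WellFoundedLT.induction with
  | ind i ih =>
    rw [Metric.tendsto_atTop']
    intro ε hε
    -- One time serves all predecessors because they are finitely many.
    have hsmall : ∀ᶠ a in atTop, ∀ j < i, ∀ τ ≥ a, ‖χ j τ‖ ≤ ε / 2 := by
      refine eventually_all.2 fun j => ?_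
      by_cases hj : j < i
      · exact (eventually_forall_ge_atTop.2
          ((ih j hj).eventually_le_const (half_pos hε))).mono fun _ h _ => h
      · exact Eventually.of_forall fun _ h => absurd h hj
    obtain ⟨a, ha, ha0⟩ := (hsmall.and (eventually_ge_atTop 0)).exists
    -- The waiting time s₀ depends on the state at time a, so a is fixed first.
    obtain ⟨s₀, hs₀⟩ := eventually_atTop.1 (((hβ.tendsto_zero ‖χ i a‖
      (norm_nonneg _)).eventually_lt_const (half_pos hε)).and (eventually_ge_atTop 0))
    refine ⟨a + s₀, fun t ht => ?_⟩
    obtain ⟨hβs, hs⟩ := hs₀ (t - a) (by linarith)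
    have hiss := (hISS N).2 (t - a) hs _ ((hχ (a + (t - a)) (by linarith)).shift ha0 hs) i
    simp only [add_zero, add_sub_cancel] at hiss
    have hp : precedingNorm (fun i t => χ i (a + t)) i (t - a) ≤ ε / 2 :=
      precedingNorm_le (half_pos hε).le fun j hj τ hτ => ha j hj _ (by linarith [hτ.1])
    have hγ := hlin _ (precedingNorm_nonneg (fun i t => χ i (a + t)) i (t - a))
    -- The gain term is at most ε/2, since γ(p) ≤ γ̃p ≤ p; the β term is strictly below ε/2.
    have hmul := mul_le_of_le_one_left
      (precedingNorm_nonneg (fun i t => χ i (a + t)) i (t - a)) hγt.2.le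
    rw [Real.dist_0_eq_abs, abs_norm]
    linarith

end Platoon

theorem theorem1 {n : ℕ} (f : Platoon.State n → Platoon.State n)
    (g : (i : ℕ) → (Fin i → Platoon.State n) → Platoon.State n)
    (hf : f 0 = 0) (hg : ∀ i, g i (fun _ => 0) = 0)
    (β : ℝ → ℝ → ℝ) (γ : ℝ → ℝ) (γt : ℝ)
    (hβ : Platoon.ClassKL β) (hγ : Platoon.ClassKInfty γ)
    (hγt : γt ∈ Set.Ioo (0 : ℝ) 1) (hlin : ∀ s, 0 ≤ s → γ s ≤ γt * s)
    (hISS : Platoon.IsISS f g β γ) :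
    Platoon.StringStable f g ∧
      (Platoon.IsolatedExponentiallyStable f → Platoon.LinearlyBounded g →
        Platoon.AsymptoticallyStringStable f g) := by
  have hstable := hISS.stringStable hβ hγt hlin
  exact ⟨hstable, fun _ _ => ⟨hstable, fun N =>
    ⟨(hISS N).1, fun _ hχ => hISS.tendsto_norm_zero hβ hγt hlin hχ⟩⟩⟩
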